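/- Let $N=2^m$, $d=2^{m-r}$ (the minimum distance of $\mathrm{RM}(m,r)$), and let $\mathrm{RM}(m,r)\subseteq\mathbb F_2^{N}$ be the set of evaluation vectors on $\mathbb F_2^m$ of the polynomials over $\mathbb F_2$ in $m$ variables of degree at most $r$. The RPA decoder (recursive projection-aggregation with one-dimensional subspaces and at most $M\ge 1$ iterations per call). For a word $Y$ on an $\mathbb F_2$-vector space $V$ and a one-dimensional subspace $B$ of $V$, the projection $Y_{/B}$ is the word on $V/B$ with $Y_{/B}(T)=\sum_{x\in T}Y(x)$. For order $1$ the decoder is a maximum-likelihood decoder: it returns an affine function $V\to\mathbb F_2$ nearest to $Y$ in Hamming distance (ties broken arbitrarily). For order $r\ge 2$ it repeats the following step at most $M$ times, stopping when $Y$ does not change, and returns $Y$: decode every $Y_{/B}$ to $\widehat Y_{/B}$ with the decoder of order $r-1$, and then flip $Y(x)$, simultaneously for all $x\in V$, exactly when $Y_{/B}(x+B)\ne\widehat Y_{/B}(x+B)$ for more than half of the one-dimensional subspaces $B$. Statement. Fix $r\ge 2$ and $\delta,\beta\in(0,1)$, and put $$\gamma_m=\left(\frac{8\,(5+m(r+1+\beta))}{d\cdot\log_2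 e}\right)^{1/2^r}.$$ Then RPA decoding of $\mathrm{RM}(m,r)$ corrects $\frac N2(1-\gamma_m-\delta)$ errors with high probability for large $m$. That is, for every $\varepsilon>0$ there is an $m_0$ such that for all $m\ge m_0$, every tie-breaking rule, every $M\ge1$, every codeword $c\in\mathrm{RM}(m,r)$ and every integer $0\le t\le\frac N2(1-\gamma_m-\delta)$, if $e$ is uniformly distributed among the vectors in $\mathbb F_2^N$ of Hamming weight $t$, then the RPA decoder maps $c+e$ to $c$ with probability at least $1-\varepsilon$. -/

import Mathlib

namespace RPA

/-- Words are `𝔽₂`-valued functions on a finite `𝔽₂`-vector space `V` of index vectors.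
The vectors of `{0,1}^m` are `Fin m → ZMod 2`; projected words are indexed by the cosets of a
subspace, i.e. by a quotient space. -/
abbrev Word (V : Type) : Type := V → ZMod 2

/-- The Reed-Muller code `RM(m, r)`: evaluations on `𝔽₂^m` of polynomials of degree at most `r`. -/
def reedMuller (m r : ℕ) : Set (Word (Fin m → ZMod 2)) :=
  {c | ∃ f : MvPolynomial (Fin m) (ZMod 2), f.totalDegree ≤ r ∧ ∀ z, c z = MvPolynomial.eval z f}

/-- The Hamming distance of two words. -/
noncomputable def dist {V : Type} (u v : Word V) : ℕ := {x | u x ≠ v x}.ncard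

/-- The Hamming weight of a word. -/
noncomputable def weight {V : Type} (u : Word V) : ℕ := {x | u x ≠ 0}.ncard

/-- The first-order Reed-Muller code on the index space `V`: all affine functions. -/
def firstOrder (V : Type) [AddCommGroup V] [Module (ZMod 2) V] : Set (Word V) :=
  {c | ∃ (s : V →ₗ[ZMod 2] ZMod 2) (a : ZMod 2), ∀ x, c x = s x + a}

/-- A map that assigns a word to every received word, on every index space. -/
abbrev WordMap : Type 1 :=
  ∀ (V : Type) [AddCommGroup V] [Module (ZMod 2) V] [Finite V], Word V → Word V

/-- `D` is a maximum likelihood decoder of first-order Reed-Muller codes over the BSC (which is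
what the Fast Hadamard Transform decoder computes): its output is a codeword nearest to the
received word. Ties may be broken in any way. -/
def IsFirstOrderML (D : WordMap) : Prop :=
  ∀ (V : Type) [AddCommGroup V] [Module (ZMod 2) V] [Finite V] (Y : Word V),
    D V Y ∈ firstOrder V ∧ ∀ f ∈ firstOrder V, dist Y (D V Y) ≤ dist Y f

/-- The one-dimensional subspaces of `V`. -/
abbrev Line (V : Type) [AddCommGroup V] [Module (ZMod 2) V] : Type :=
  {B : Submodule (ZMod 2) V // Module.finrank (ZMod 2) B = 1}

instance finite_quotient (V : Type) [AddCommGroup V] [Module (ZMod 2) V] [Finite V]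
    (B : Submodule (ZMod 2) V) : Finite (V ⧸ B) :=
  Finite.of_surjective B.mkQ B.mkQ_surjective

section

variable {V : Type} [AddCommGroup V] [Module (ZMod 2) V]

/-- The projection of `Y` onto the cosets of `B`: the entry at a coset `T` is the sum modulo two of
the entries of `Y` with index in `T`. -/
noncomputable def project (B : Line V) (Y : Word V) : Word (V ⧸ B.1) :=
  fun T => ∑ᶠ x ∈ {x : V | B.1.mkQ x = T}, Y x

/-- The number of subspaces `B` at which the projection of `Y` and its decoded version `Yhat B`
differ in the coset of `x`. -/
noncomputable def disagreements (Y : Word V) (Yhat : ∀ B : Line V, Word (V ⧸ B.1)) (x : V) : ℕ :=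
  {B : Line V | project B Y (B.1.mkQ x) ≠ Yhat B (B.1.mkQ x)}.ncard

open Classical in
/-- The aggregation step: the entry at `x` is flipped if and only if more than half of the
subspaces disagree at the coset of `x`. -/
noncomputable def aggregate (Y : Word V) (Yhat : ∀ B : Line V, Word (V ⧸ B.1)) : Word V :=
  fun x => Y x + if (Nat.card (Line V) : ℝ) / 2 < disagreements Y Yhat x then 1 else 0

end

open Classical in
/-- The loop of the decoder: apply `step` at most `M` times, stopping when nothing changes. -/
noncomputable def loop {W : Type} (step : W → W) : ℕ → W → W
  | 0, Y => Y
  | M + 1, Y => if Y = step Y then Y else loop step M (step Y)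

/-- The recursive projection-aggregation decoder of order `r` with one-dimensional subspaces, at
most `M` iterations in each call, and the decoder `D` for first-order codes. For `r = 1` it is `D`;
order `0` is never reached from `r ≥ 1` and the word is left unchanged there. -/
noncomputable def decoder (D : WordMap) (M : ℕ) :
    ℕ → ∀ (V : Type) [AddCommGroup V] [Module (ZMod 2) V] [Finite V], Word V → Word V
  | 0, _, _, _, _ => fun Y => Y
  | 1, V, _, _, _ => D V
  | r + 2, V, _, _, _ =>
      loop (fun Y => aggregate Y (fun B => decoder D M (r + 1) (V ⧸ B.1) (project B Y))) M

/-- The probability that `dec` recovers the codeword `c` when the error pattern is uniformly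
distributed among all error patterns of weight `t`. -/
noncomputable def correctionProb {V : Type} (dec : Word V → Word V) (c : Word V) (t : ℕ) : ℝ :=
  ({e : Word V | weight e = t ∧ dec (c + e) = c}.ncard : ℝ) / ({e : Word V | weight e = t}.ncard : ℝ)

/-- `γ_m = (8 (5 + m (r + 1 + β)) / (d log₂ e)) ^ (1 / 2 ^ r)` with `d = 2 ^ (m - r)`. -/
noncomputable def gamma (r : ℕ) (β : ℝ) (m : ℕ) : ℝ :=
  (8 * (5 + m * (r + 1 + β)) / ((2 : ℝ) ^ (m - r) * Real.logb 2 (Real.exp 1))) ^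
    ((1 : ℝ) / 2 ^ r)

/-- Maximum likelihood decoders of first-order codes exist. -/
theorem exists_isFirstOrderML : ∃ D : WordMap, IsFirstOrderML D := by
  have key : ∀ (V : Type) [AddCommGroup V] [Module (ZMod 2) V] (Y : Word V),
      ∃ g ∈ firstOrder V, ∀ f ∈ firstOrder V, dist Y g ≤ dist Y f := by
    intro V _ _ Y
    have hne : (firstOrder V).Nonempty := ⟨fun _ => 0, 0, 0, by simp⟩
    obtain ⟨g, hg, hmin⟩ := exists_minimalFor_of_wellFoundedLT (· ∈ firstOrder V) (dist Y) hne
    refine ⟨g, hg, fun f hf => ?_⟩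
    rcases le_total (dist Y g) (dist Y f) with h | h
    · exact h
    · exact hmin hf h
  exact ⟨fun V _ _ _ Y => (key V Y).choose, fun V _ _ _ Y => (key V Y).choose_spec⟩

end RPA

/-! The argument separates a deterministic criterion from a probability estimate.

Projection along {0, b} sends e to the derivative e(x) + e(x + b). If all projections decode
correctly, the votes at x count the y with e(y) ≠ e(x), so one aggregation step removes every error
once e has weight below N/2. At order 1, maximum likelihood succeeds if e is a minority on the
support of every nonzero affine function. Hence `Good` patterns are corrected in one iteration, and
further iterations fix the codeword (`decoder_eq`).

On a binary symmetric channel with bias ρ = 1 - 2p, a projected entry is the sum of two independent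
entries, so its bias is ρ² (`HasBias.project`). With ρ ≥ δ, each of at most (2N)^r bad events has
probability at most (1 - δ^(2^r)/2)^(N/2^r) (`HasBias.tail`, `not_good_le`). Conditioning on weight
t with p = t/N costs a factor N + 1 (`ncard_le_of_mass_le`). For fixed δ the bound decays
exponentially in N against a polynomial factor, so of γ only nonnegativity matters. -/

namespace RPA

/-! ### Lines, projections and the aggregation vote -/

section Lines

variable {V : Type} [AddCommGroup V] [Module (ZMod 2) V]

theorem add_self_eq_zero (x : V) : x + x = 0 := by
  rw [← two_smul (ZMod 2) x, show (2 : ZMod 2) = 0 from rfl, zero_smul]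

theorem zmod_two_cases (a : ZMod 2) : a = 0 ∨ a = 1 := by
  revert a; decide

theorem mem_span_singleton_iff {b y : V} :
    y ∈ Submodule.span (ZMod 2) {b} ↔ y = 0 ∨ y = b := by
  rw [Submodule.mem_span_singleton]
  constructor
  · rintro ⟨a, rfl⟩
    rcases zmod_two_cases a with rfl | rfl <;> simp
  · rintro (rfl | rfl)
    · exact ⟨0, by simp⟩
    · exact ⟨1, by simp⟩

/-- The one-dimensional subspace through a nonzero vector. -/
def lineOf (b : {b : V // b ≠ 0}) : Line V :=
  ⟨Submodule.span (ZMod 2) {b.1}, finrank_span_singleton b.2⟩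

/-- Over 𝔽₂ a line contains exactly one nonzero vector. -/
theorem lineOf_bijective : Function.Bijective (lineOf (V := V)) := by
  constructor
  · rintro ⟨b, hb⟩ ⟨c, hc⟩ h
    have h0 : Submodule.span (ZMod 2) {b} = Submodule.span (ZMod 2) {c} := congrArg Subtype.val h
    have h1 : b ∈ Submodule.span (ZMod 2) {c} := h0 ▸ Submodule.mem_span_singleton_self b
    rcases mem_span_singleton_iff.1 h1 with h2 | h2
    · exact absurd h2 hb
    · exact Subtype.ext h2
  · rintro ⟨B, hB⟩
    obtain ⟨v, hv, hspan⟩ := finrank_eq_one_iff'.1 hB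
    refine ⟨⟨v.1, fun h => hv (Subtype.ext h)⟩, Subtype.ext ?_⟩
    apply le_antisymm
    · exact (Submodule.span_singleton_le_iff_mem _ _).2 v.2
    · intro y hy
      obtain ⟨a, ha⟩ := hspan ⟨y, hy⟩
      exact Submodule.mem_span_singleton.2 ⟨a, congrArg Subtype.val ha⟩

theorem project_lineOf_apply (b : {b : V // b ≠ 0}) (Y : Word V) (x : V) :
    project (lineOf b) Y ((lineOf b).1.mkQ x) = Y x + Y (x + b.1) := by
  have hset : {y : V | (lineOf b).1.mkQ y = (lineOf b).1.mkQ x} = {x, x + b.1} := by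
    ext y
    rw [Set.mem_ofPred_eq, Submodule.mkQ_apply, Submodule.mkQ_apply, Submodule.Quotient.eq]
    refine (mem_span_singleton_iff (b := b.1)).trans ?_
    rw [sub_eq_zero, sub_eq_iff_eq_add, add_comm b.1 x]
    rfl
  rw [project, hset, finsum_mem_pair]
  intro h
  exact b.2 (by simpa using h)

theorem project_add (B : Line V) (Y Z : Word V) :
    project B (Y + Z) = project B Y + project B Z := by
  obtain ⟨b, rfl⟩ := lineOf_bijective.2 B
  funext T
  obtain ⟨x, rfl⟩ := (lineOf b).1.mkQ_surjective T
  simp only [Pi.add_apply, project_lineOf_apply]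
  ring

theorem project_zero (B : Line V) : project B (0 : Word V) = 0 := by
  funext T
  simp [project]

theorem card_line [Finite V] : Nat.card (Line V) + 1 = Nat.card V := by
  classical
  have := Fintype.ofFinite V
  rw [← Nat.card_congr (Equiv.ofBijective _ (lineOf_bijective (V := V))), Nat.card_eq_fintype_card,
    Nat.card_eq_fintype_card, Fintype.card_subtype_compl, Fintype.card_subtype_eq]
  have : 0 < Fintype.card V := Fintype.card_pos
  omega

theorem card_quotient_line (B : Line V) : Nat.card V = 2 * Nat.card (V ⧸ B.1) := by
  have : Module.Finite (ZMod 2) B.1 := Module.finite_of_finrank_pos (by rw [B.2]; exact one_pos)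
  rw [Submodule.card_eq_card_quotient_mul_card B.1, Module.natCard_eq_pow_finrank (K := ZMod 2)
    (V := B.1), B.2]
  simp

theorem disagreements_eq [Finite V] (c e : Word V) (x : V) :
    disagreements (c + e) (fun B => project B c) x = {y | e y ≠ e x}.ncard := by
  have h : {B : Line V | project B (c + e) (B.1.mkQ x) ≠ project B c (B.1.mkQ x)}
      = lineOf '' {b : {b : V // b ≠ 0} | e (x + b.1) ≠ e x} := by
    ext B
    obtain ⟨b, rfl⟩ := lineOf_bijective.2 B
    rw [lineOf_bijective.1.mem_set_image, Set.mem_ofPred_eq, Set.mem_ofPred_eq, project_add,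
      Pi.add_apply, Ne, add_eq_left, project_lineOf_apply, add_eq_zero_iff_eq_neg,
      ZModModule.neg_eq_self, Ne, eq_comm]
  rw [disagreements, h, Set.ncard_image_of_injective _ lineOf_bijective.1]
  have h2 : {y | e y ≠ e x} = (fun b : {b : V // b ≠ 0} => x + b.1) ''
      {b : {b : V // b ≠ 0} | e (x + b.1) ≠ e x} := by
    ext y
    constructor
    · intro hy
      refine ⟨⟨y - x, fun h0 => hy ?_⟩, ?_, ?_⟩
      · rw [sub_eq_zero.1 h0]
      · simpa using hy
      · simp
    · rintro ⟨b, hb, rfl⟩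
      exact hb
  rw [h2, Set.ncard_image_of_injective]
  intro a b hab
  exact Subtype.ext (add_left_cancel hab)

theorem aggregate_eq [Finite V] {c e : Word V} (he : 2 * weight e < Nat.card V) :
    aggregate (c + e) (fun B => project B c) = c := by
  funext x
  have hline := card_line (V := V)
  have hl : ((Nat.card (Line V) : ℕ) : ℝ) + 1 = Nat.card V := by exact_mod_cast hline
  have hcompl : {y | e y = 0}.ncard + weight e = Nat.card V := by
    rw [weight, ← Set.ncard_add_ncard_compl {y | e y = 0}]
    rfl
  rw [aggregate, disagreements_eq]
  rcases zmod_two_cases (e x) with h | h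
  · rw [if_neg]
    · simp [h]
    · simp only [h]
      change ¬ (_ < ((weight e : ℕ) : ℝ))
      -- There are only N - 1 lines, so integrality is needed: 2w < N gives 2w ≤ N - 1.
      have : ((2 * weight e + 1 : ℕ) : ℝ) ≤ (Nat.card V : ℕ) := by exact_mod_cast he
      push_cast at this
      linarith
  · have hs : {y | e y ≠ e x} = {y | e y = 0} := by
      ext y
      rcases zmod_two_cases (e y) with h' | h' <;> simp [h, h']
    rw [if_pos]
    · simp only [Pi.add_apply, h]
      rw [add_assoc, show (1 : ZMod 2) + 1 = 0 from rfl, add_zero]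
    · rw [hs]
      have : ((2 * {y | e y = 0}.ncard : ℕ) : ℝ) ≥ (Nat.card V : ℕ) := by
        exact_mod_cast (by omega)
      push_cast at this
      linarith

end Lines

/-! ### Deterministic correction of good error patterns -/

/-- The Reed-Muller code of order `r` on an arbitrary index space, described by projections. -/
def IsRM : ℕ → ∀ (V : Type) [AddCommGroup V] [Module (ZMod 2) V], Word V → Prop
  | 0, _, _, _ => fun _ => True
  | 1, V, _, _ => fun c => c ∈ firstOrder V
  | r + 2, V, _, _ => fun c => ∀ B : Line V, IsRM (r + 1) (V ⧸ B.1) (project B c)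

/-- The word `e` is nonzero on less than half of `U`. -/
def Minority {V : Type} (e : Word V) (U : Set V) : Prop :=
  2 * {x | x ∈ U ∧ e x ≠ 0}.ncard < U.ncard

/-- The error patterns that are certainly corrected: they and their iterated projections have
weight less than half the length, and the final projections are less than half on the support of
every nonzero affine function. -/
def Good : ℕ → ∀ (V : Type) [AddCommGroup V] [Module (ZMod 2) V], Word V → Prop
  | 0, _, _, _ => fun _ => True
  | 1, V, _, _ => fun e => ∀ f ∈ firstOrder V, f ≠ 0 → Minority e {x | f x ≠ 0}
  | r + 2, V, _, _ => fun e =>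
      Minority e Set.univ ∧ ∀ B : Line V, Good (r + 1) (V ⧸ B.1) (project B e)

theorem minority_zero {V : Type} [Finite V] {U : Set V} (hU : U.Nonempty) :
    Minority (0 : Word V) U := by
  simpa [Minority] using (Set.ncard_pos (Set.toFinite U)).2 hU

/-- Used to show that a codeword is a fixed point of the decoding step. -/
theorem good_zero (r : ℕ) : ∀ (V : Type) [AddCommGroup V] [Module (ZMod 2) V] [Finite V],
    Good (r + 1) V 0 := by
  induction r with
  | zero =>
    intro V _ _ _ f _ hne
    exact minority_zero (Function.ne_iff.1 hne)
  | succ r ih =>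
    intro V _ _ _
    refine ⟨minority_zero Set.univ_nonempty, fun B => ?_⟩
    rw [project_zero]
    exact ih _

theorem firstOrder_sub_mem {V : Type} [AddCommGroup V] [Module (ZMod 2) V] {f g : Word V}
    (hf : f ∈ firstOrder V) (hg : g ∈ firstOrder V) : f - g ∈ firstOrder V := by
  obtain ⟨s, a, hs⟩ := hf
  obtain ⟨t, b, ht⟩ := hg
  refine ⟨s - t, a - b, fun x => ?_⟩
  simp only [Pi.sub_apply, hs, ht, LinearMap.sub_apply]
  ring

theorem firstOrder_decode {V : Type} [AddCommGroup V] [Module (ZMod 2) V] [Finite V]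
    {D : WordMap} (hD : IsFirstOrderML D) {c e : Word V} (hc : c ∈ firstOrder V)
    (he : Good 1 V e) : D V (c + e) = c := by
  obtain ⟨hg, hmin⟩ := hD V (c + e)
  set g := D V (c + e)
  by_contra hne
  have hmaj := he (g - c) (firstOrder_sub_mem hg hc) (sub_ne_zero.2 hne)
  have hle := hmin c hc
  set F : Set V := {x | (g - c) x ≠ 0}
  have h1 : dist (c + e) c = weight e := by
    simp [dist, weight]
  -- Passing from c to g replaces the error support by its symmetric difference with F; as e is a
  -- minority on F, this increases the distance.
  have h2 : dist (c + e) g = ((F \ {x | e x ≠ 0}) ∪ ({x | e x ≠ 0} \ F)).ncard := by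
    rw [dist]
    congr 1
    ext x
    simp only [F, Set.mem_ofPred_eq, Set.mem_union, Set.mem_sdiff, Pi.add_apply, Pi.sub_apply]
    generalize c x = a
    generalize e x = b
    generalize g x = d
    revert a b d
    decide
  rw [h1, h2, Set.ncard_union_eq (Set.disjoint_left.2 fun x hx hx' => hx.2 hx'.1), weight] at hle
  have h3 := Set.ncard_inter_add_ncard_sdiff_eq_ncard F {x | e x ≠ 0}
  have h4 := Set.ncard_inter_add_ncard_sdiff_eq_ncard {x | e x ≠ 0} F
  rw [Set.inter_comm] at h4
  have h5 : 2 * (F ∩ {x | e x ≠ 0}).ncard < F.ncard := hmaj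
  omega

theorem loop_eq {W : Type} {step : W → W} {c : W} (hc : step c = c) :
    ∀ M, loop step M c = c
  | 0 => rfl
  | M + 1 => by rw [loop, if_pos hc.symm]

theorem decoder_eq {D : WordMap} (hD : IsFirstOrderML D) {M : ℕ} (hM : 1 ≤ M) (r : ℕ) :
    ∀ (V : Type) [AddCommGroup V] [Module (ZMod 2) V] [Finite V] (c e : Word V),
      IsRM (r + 1) V c → Good (r + 1) V e → decoder D M (r + 1) V (c + e) = c := by
  induction r with
  | zero => exact fun V _ _ _ c e hc he => firstOrder_decode hD hc he
  | succ r ih =>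
    intro V _ _ _ c e hc he
    have hstep : ∀ e : Word V, Good (r + 2) V e →
        aggregate (c + e) (fun B => decoder D M (r + 1) (V ⧸ B.1) (project B (c + e))) = c := by
      intro e he
      have h : (fun B : Line V => decoder D M (r + 1) (V ⧸ B.1) (project B (c + e)))
          = fun B => project B c := by
        funext B
        rw [project_add]
        exact ih _ _ _ (hc B) (he.2 B)
      rw [h]
      refine aggregate_eq ?_
      simpa [Minority, weight, Set.ncard_univ] using he.1
    obtain ⟨M, rfl⟩ := Nat.exists_eq_add_of_le' hM
    have hfix := hstep 0 (good_zero (r + 1) V)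
    rw [add_zero] at hfix
    rw [decoder, loop]
    split_ifs with h
    · rw [h]
      exact hstep e he
    · rw [hstep e he]
      exact loop_eq hfix M


/-! ### Polynomial degree via iterated derivatives -/

/-- The words all of whose `r + 1`-fold derivatives vanish. -/
def HasDegreeLE {V : Type} [AddCommGroup V] : ℕ → Word V → Prop
  | 0, f => ∀ x y, f x = f y
  | r + 1, f => ∀ b, HasDegreeLE r fun x => f x + f (x + b)

theorem HasDegreeLE.of_comp {V W : Type} [AddCommGroup V] [AddCommGroup W] {π : V →+ W}
    (hπ : Function.Surjective π) {r : ℕ} {f : Word W} (h : HasDegreeLE r fun x => f (π x)) :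
    HasDegreeLE r f := by
  induction r generalizing f with
  | zero =>
    intro x y
    obtain ⟨x, rfl⟩ := hπ x
    obtain ⟨y, rfl⟩ := hπ y
    exact h x y
  | succ r ih =>
    intro b
    obtain ⟨b, rfl⟩ := hπ b
    refine ih ?_
    simpa using h b

/-- A projection, pulled back to V, is the derivative in the direction of the line, so it loses one
degree. In degree 1, constancy of the derivatives makes f + f(0) additive. -/
theorem HasDegreeLE.isRM {r : ℕ} : ∀ {V : Type} [AddCommGroup V] [Module (ZMod 2) V]
    {f : Word V}, HasDegreeLE (r + 1) f → IsRM (r + 1) V f := by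
  induction r with
  | zero =>
    intro V _ _ f h
    refine ⟨(AddMonoidHom.mk' (fun x => f x + f 0) ?_).toZModLinearMap 2, f 0, fun x => ?_⟩
    · intro x b
      have := h b x 0
      simp only [zero_add] at this
      linear_combination this - CharTwo.add_self_eq_zero (f x)
    · simp [add_assoc, CharTwo.add_self_eq_zero]
  | succ r ih =>
    intro V _ _ f h B
    obtain ⟨b, rfl⟩ := lineOf_bijective.2 B
    refine ih (HasDegreeLE.of_comp (π := (lineOf b).1.mkQ.toAddMonoidHom)
      (lineOf b).1.mkQ_surjective ?_)
    have : (fun x => project (lineOf b) f ((lineOf b).1.mkQ x)) = fun x => f x + f (x + b.1) :=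
      funext fun x => project_lineOf_apply b f x
    change HasDegreeLE (r + 1) fun x => project (lineOf b) f ((lineOf b).1.mkQ x)
    rw [this]
    exact h b

theorem HasDegreeLE.add {V : Type} [AddCommGroup V] {r : ℕ} {f g : Word V}
    (hf : HasDegreeLE r f) (hg : HasDegreeLE r g) : HasDegreeLE r fun x => f x + g x := by
  induction r generalizing f g with
  | zero => intro x y; simp only [hf x y, hg x y]
  | succ r ih =>
    intro b
    convert ih (hf b) (hg b) using 2
    ring

theorem HasDegreeLE.shift {V : Type} [AddCommGroup V] {r : ℕ} {f : Word V}
    (hf : HasDegreeLE r f) (b : V) : HasDegreeLE r fun x => f (x + b) := by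
  induction r generalizing f with
  | zero => exact fun x y => hf _ _
  | succ r ih =>
    intro c
    convert ih (hf c) using 2
    rw [add_right_comm]

theorem hasDegreeLE_const {V : Type} [AddCommGroup V] (r : ℕ) (a : ZMod 2) :
    HasDegreeLE r fun _ : V => a := by
  induction r generalizing a with
  | zero => exact fun _ _ => rfl
  | succ r ih => exact fun _ => ih _

theorem HasDegreeLE.succ {V : Type} [AddCommGroup V] {r : ℕ} {f : Word V}
    (hf : HasDegreeLE r f) : HasDegreeLE (r + 1) f := by
  induction r generalizing f with
  | zero => exact fun b x y => by simp only [hf x y, hf (x + b) (y + b)]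
  | succ r ih => exact fun b => ih (hf b)

theorem HasDegreeLE.mono {V : Type} [AddCommGroup V] {r s : ℕ} (h : r ≤ s) {f : Word V}
    (hf : HasDegreeLE r f) : HasDegreeLE s f := by
  induction h with
  | refl => exact hf
  | step _ ih => exact ih.succ

/-- Leibniz rule: the derivative of l · f along b is l · (derivative of f) + l(b) · f(· + b). -/
theorem HasDegreeLE.add_hom_mul {V : Type} [AddCommGroup V] {r : ℕ} {f : Word V}
    (hf : HasDegreeLE r f) (l : V →+ ZMod 2) : HasDegreeLE (r + 1) fun x => l x * f x := by
  induction r generalizing f with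
  | zero =>
    intro b x y
    simp only [hf x 0, hf y 0, hf (x + b) 0, hf (y + b) 0, map_add]
    linear_combination
      f 0 * CharTwo.add_self_eq_zero (l x) - f 0 * CharTwo.add_self_eq_zero (l y)
  | succ r ih =>
    intro b
    have h1 := ih (hf b)
    have h2 : HasDegreeLE (r + 1) fun x => l b * f (x + b) := by
      rcases zmod_two_cases (l b) with h | h
      · simpa [h] using hasDegreeLE_const (V := V) (r + 1) 0
      · simpa [h] using hf.shift b
    convert h1.add h2 using 2
    simp only [map_add]
    ring

theorem hasDegreeLE_multiset_prod {m : ℕ} (t : Multiset (Fin m)) :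
    HasDegreeLE t.card fun z : Fin m → ZMod 2 => (t.map z).prod := by
  induction t using Multiset.induction_on with
  | empty => simpa using hasDegreeLE_const (V := Fin m → ZMod 2) 0 1
  | cons i t ih => simpa using ih.add_hom_mul (Pi.evalAddMonoidHom (fun _ => ZMod 2) i)

theorem HasDegreeLE.finset_sum {V ι : Type} [AddCommGroup V] {r : ℕ} (s : Finset ι)
    {f : ι → Word V} (h : ∀ i ∈ s, HasDegreeLE r (f i)) :
    HasDegreeLE r fun x => ∑ i ∈ s, f i x := by
  classical
  induction s using Finset.induction_on with
  | empty => simpa using hasDegreeLE_const (V := V) r 0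
  | insert i s hi ih =>
    simp only [Finset.sum_insert hi]
    exact (h i (Finset.mem_insert_self i s)).add
      (ih fun j hj => h j (Finset.mem_insert_of_mem hj))

theorem isRM_of_mem_reedMuller {m r : ℕ} {c : Word (Fin m → ZMod 2)}
    (hc : c ∈ reedMuller m (r + 1)) : IsRM (r + 1) _ c := by
  obtain ⟨f, hf, hcf⟩ := hc
  refine HasDegreeLE.isRM ?_
  rw [funext hcf]
  simp only [MvPolynomial.eval_eq]
  refine HasDegreeLE.finset_sum _ fun d hd => ?_
  have hdeg : HasDegreeLE (r + 1) fun z : Fin m → ZMod 2 => ∏ i ∈ d.support, z i ^ d i := by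
    have h := hasDegreeLE_multiset_prod (Finsupp.toMultiset d)
    simp only [Finsupp.toMultiset_map, Finsupp.prod_toMultiset, Finsupp.card_toMultiset] at h
    have h' := h.mono ((MvPolynomial.le_totalDegree hd).trans hf)
    convert h' using 2 with z
    rw [Finsupp.prod_mapDomain_index (by simp) (by intros; rw [pow_add])]
    rfl
  rcases zmod_two_cases (f.coeff d) with h | h
  · simpa [h] using hasDegreeLE_const (V := Fin m → ZMod 2) (r + 1) 0
  · simpa [h] using hdeg


/-! ### Bias, tail bound and union bound -/

/-- The additive character of `𝔽₂` with values `±1`. -/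
noncomputable def sgn (z : ZMod 2) : ℝ := if z = 0 then 1 else -1

theorem sgn_add (a b : ZMod 2) : sgn (a + b) = sgn a * sgn b := by
  rcases zmod_two_cases a with rfl | rfl <;> rcases zmod_two_cases b with rfl | rfl <;>
    simp [sgn, show (1 : ZMod 2) + 1 = 0 from rfl]

/-- The total weight of a set under a weight function on a finite type. -/
noncomputable def mass {Ω : Type} [Fintype Ω] (P : Ω → ℝ) (S : Set Ω) : ℝ :=
  ∑ ω, S.indicator P ω

section Mass

variable {Ω : Type} [Fintype Ω] {P : Ω → ℝ}

theorem mass_mono (hP : ∀ ω, 0 ≤ P ω) {S T : Set Ω} (h : S ⊆ T) : mass P S ≤ mass P T :=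
  Finset.sum_le_sum fun ω _ => Set.indicator_le_indicator_of_subset h hP ω

theorem mass_union_le (hP : ∀ ω, 0 ≤ P ω) (S T : Set Ω) :
    mass P (S ∪ T) ≤ mass P S + mass P T := by
  rw [mass, mass, mass, ← Finset.sum_add_distrib]
  refine Finset.sum_le_sum fun ω _ => ?_
  have h := hP ω
  by_cases h1 : ω ∈ S <;> by_cases h2 : ω ∈ T <;> simp [h1, h2, h]

theorem mass_iUnion_le (hP : ∀ ω, 0 ≤ P ω) {ι : Type} [Fintype ι] (S : ι → Set Ω) :
    mass P (⋃ i, S i) ≤ ∑ i, mass P (S i) := by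
  simp only [mass]
  rw [Finset.sum_comm]
  refine Finset.sum_le_sum fun ω _ => ?_
  have hnn : ∀ i, 0 ≤ (S i).indicator P ω := fun i => Set.indicator_nonneg (fun ω _ => hP ω) ω
  by_cases h : ω ∈ ⋃ i, S i
  · obtain ⟨i, hi⟩ := Set.mem_iUnion.1 h
    rw [Set.indicator_of_mem h, ← Set.indicator_of_mem hi P]
    exact Finset.single_le_sum (f := fun i => (S i).indicator P ω) (fun i _ => hnn i)
      (Finset.mem_univ i)
  · rw [Set.indicator_of_notMem h]
    exact Finset.sum_nonneg fun i _ => hnn i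

end Mass

/-- The entries of the random word `X` are independent, and each is nonzero with probability
`(1 - ρ) / 2`. This is expressed by character sums. -/
def HasBias {Ω V : Type} [Fintype Ω] (P : Ω → ℝ) (X : Ω → Word V) (ρ : ℝ) : Prop :=
  ∀ A : Finset V, ∑ ω, P ω * ∏ u ∈ A, sgn (X ω u) = ρ ^ A.card

/-- A character on a set A of cosets pulls back to the character on the union of these cosets, which
has 2|A| elements. -/
theorem HasBias.project {Ω V : Type} [Fintype Ω] [AddCommGroup V] [Module (ZMod 2) V]
    {P : Ω → ℝ} {X : Ω → Word V} {ρ : ℝ} (h : HasBias P X ρ) (B : Line V) :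
    HasBias P (fun ω => project B (X ω)) (ρ ^ 2) := by
  classical
  intro A
  obtain ⟨b, rfl⟩ := lineOf_bijective.2 B
  obtain ⟨σ, hσ⟩ := (lineOf b).1.mkQ_surjective.hasRightInverse
  have hb : (lineOf b).1.mkQ b.1 = 0 := by
    rw [← LinearMap.mem_ker, Submodule.ker_mkQ]
    exact Submodule.mem_span_singleton_self b.1
  have hinj : Function.Injective σ := hσ.injective
  have hinj' : Function.Injective fun u => σ u + b.1 := fun u v huv => hinj (add_right_cancel huv)
  have hdisj : Disjoint (A.image σ) (A.image fun u => σ u + b.1) := by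
    rw [Finset.disjoint_left]
    intro x hx hx'
    obtain ⟨u, -, rfl⟩ := Finset.mem_image.1 hx
    obtain ⟨v, -, hv⟩ := Finset.mem_image.1 hx'
    have huv := congrArg (lineOf b).1.mkQ hv
    rw [map_add, hb, add_zero, hσ, hσ] at huv
    subst huv
    exact b.2 (by simpa using hv)
  have := h (A.image σ ∪ A.image fun u => σ u + b.1)
  rw [Finset.card_union_of_disjoint hdisj, Finset.card_image_of_injective _ hinj,
    Finset.card_image_of_injective _ hinj', ← two_mul, pow_mul] at this
  rw [← this]
  refine Finset.sum_congr rfl fun ω _ => ?_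
  rw [Finset.prod_union hdisj, Finset.prod_image hinj.injOn, Finset.prod_image hinj'.injOn,
    ← Finset.prod_mul_distrib]
  congr 1
  refine Finset.prod_congr rfl fun u _ => ?_
  rw [← sgn_add, ← project_lineOf_apply, hσ]

/-- A Chernoff bound: if at least half the entries are nonzero, the product of the factors `g` is at
least 1, and its expectation factorizes after expansion into characters. -/
theorem HasBias.tail {Ω V : Type} [Fintype Ω] [Finite V] {P : Ω → ℝ} (hP : ∀ ω, 0 ≤ P ω)
    {X : Ω → Word V} {ρ : ℝ} (h : HasBias P X ρ) (hρ : 0 ≤ ρ) (U : Set V) :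
    mass P {ω | ¬ Minority (X ω) U} ≤ (1 - ρ ^ 2 / 2) ^ U.ncard := by
  classical
  obtain ⟨U, rfl⟩ : ∃ U' : Finset V, U = U' := ⟨U.toFinite.toFinset, by simp⟩
  rw [Set.ncard_coe_finset]
  -- The optimal base is √((1 + ρ)/(1 - ρ)); 1 + ρ avoids the pole at ρ = 1 and gives the mean 1 -
  -- ρ²/2 exactly.
  set g : ZMod 2 → ℝ := fun z => if z ≠ 0 then 1 + ρ else (1 + ρ)⁻¹ with hg
  set a : ℝ := ((1 + ρ)⁻¹ + (1 + ρ)) / 2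
  set b : ℝ := ((1 + ρ)⁻¹ - (1 + ρ)) / 2
  have hgab : ∀ z, g z = b * sgn z + a := by
    intro z
    rcases zmod_two_cases z with rfl | rfl <;> simp [hg, sgn, a, b] <;> ring
  have hmean : b * ρ + a = 1 - ρ ^ 2 / 2 := by
    have : 1 + ρ ≠ 0 := by positivity
    simp only [a, b]
    field_simp
    ring
  have hprod : ∀ ω, ¬ Minority (X ω) (U : Set V) → 1 ≤ ∏ u ∈ U, g (X ω u) := by
    intro ω hω
    have hcount : {x | x ∈ (U : Set V) ∧ X ω x ≠ 0} = (U.filter (X ω · ≠ 0) : Finset V) := by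
      ext x
      simp
    rw [Minority, hcount, Set.ncard_coe_finset, Set.ncard_coe_finset, not_lt,
      ← Finset.card_filter_add_card_filter_not (s := U) (X ω · ≠ 0), two_mul] at hω
    obtain ⟨i, hi⟩ := Nat.exists_eq_add_of_le (Nat.le_of_add_le_add_left hω)
    rw [Finset.prod_ite, Finset.prod_const, Finset.prod_const, hi, pow_add, mul_right_comm,
      ← mul_pow, mul_inv_cancel₀ (by positivity), one_pow, one_mul]
    exact one_le_pow₀ (by linarith)
  calc mass P {ω | ¬ Minority (X ω) (U : Set V)}
      ≤ ∑ ω, P ω * ∏ u ∈ U, g (X ω u) := by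
        refine Finset.sum_le_sum fun ω _ => ?_
        by_cases hω : Minority (X ω) (U : Set V)
        · rw [Set.indicator_of_notMem (by simpa using hω)]
          refine mul_nonneg (hP ω) (Finset.prod_nonneg fun u _ => ?_)
          simp only [hg]
          split_ifs <;> positivity
        · rw [Set.indicator_of_mem (by simpa using hω)]
          exact le_mul_of_one_le_right (hP ω) (hprod ω hω)
    _ = ∑ A ∈ U.powerset, b ^ A.card * a ^ (U \ A).card *
          ∑ ω, P ω * ∏ u ∈ A, sgn (X ω u) := by
        simp only [hgab, Finset.prod_add, Finset.mul_sum, Finset.prod_mul_distrib,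
          Finset.prod_const]
        rw [Finset.sum_comm]
        refine Finset.sum_congr rfl fun A _ => Finset.sum_congr rfl fun ω _ => ?_
        ring
    _ = ∏ u ∈ U, (b * ρ + a) := by
        rw [Finset.prod_add]
        refine Finset.sum_congr rfl fun A _ => ?_
        rw [h A, Finset.prod_const, Finset.prod_const, mul_pow]
        ring
    _ = (1 - ρ ^ 2 / 2) ^ U.card := by rw [Finset.prod_const, hmean]

theorem card_le_two_mul_support {V : Type} [AddCommGroup V] [Module (ZMod 2) V] [Finite V]
    {f : Word V} (hf : f ∈ firstOrder V) (hne : f ≠ 0) :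
    Nat.card V ≤ 2 * {x | f x ≠ 0}.ncard := by
  obtain ⟨s, a, hs⟩ := hf
  have hsplit : {x | f x = 0}.ncard + {x | f x ≠ 0}.ncard = Nat.card V := by
    rw [← Set.ncard_add_ncard_compl {x | f x = 0}]
    rfl
  suffices {x | f x = 0}.ncard ≤ {x | f x ≠ 0}.ncard by omega
  by_cases h : ∃ v, s v ≠ 0
  · obtain ⟨v, hv⟩ := h
    -- Translation by v flips the value of f.
    refine Set.ncard_le_ncard_of_injOn (· + v) (fun x hx => ?_)
      (fun x _ y _ hxy => add_right_cancel hxy)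
    rw [Set.mem_ofPred_eq, hs] at hx ⊢
    rw [map_add, add_right_comm, hx, zero_add]
    exact hv
  · push Not at h
    have hfa : ∀ x, f x = a := fun x => by rw [hs, h, zero_add]
    have ha : a ≠ 0 := fun ha => hne (funext fun x => by rw [hfa, ha]; rfl)
    simp [hfa, ha]

theorem card_dual (V : Type) [AddCommGroup V] [Module (ZMod 2) V] [Finite V] :
    Nat.card (V →ₗ[ZMod 2] ZMod 2) = Nat.card V := by
  rw [Module.natCard_eq_pow_finrank (K := ZMod 2) (V := V),
    Module.natCard_eq_pow_finrank (K := ZMod 2) (V := V →ₗ[ZMod 2] ZMod 2)]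
  congr 1
  exact Subspace.dual_finrank_eq

/-- Each level contributes one weight event and fewer than N lines; the last has at most 2N affine
functions. The r squarings keep the bias at least τ, and r halvings of V plus one for the affine
support leave sets of size at least L. -/
theorem not_good_le {Ω : Type} [Fintype Ω] {P : Ω → ℝ} (hP : ∀ ω, 0 ≤ P ω) {τ : ℝ} (hτ : 0 ≤ τ)
    {L : ℕ} {N : ℝ} (hN : 1 ≤ N) (r : ℕ) :
    ∀ (V : Type) [AddCommGroup V] [Module (ZMod 2) V] [Finite V] (X : Ω → Word V) (ρ : ℝ),
      HasBias P X ρ → 0 ≤ ρ → ρ ≤ 1 → τ ≤ ρ ^ 2 ^ r → 2 ^ (r + 1) * L ≤ Nat.card V →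
      Nat.card V ≤ N →
      mass P {ω | ¬ Good (r + 1) V (X ω)} ≤ (2 * N) ^ (r + 1) * (1 - τ ^ 2 / 2) ^ L := by
  have key : ∀ (V : Type) [Finite V] (X : Ω → Word V) (ρ : ℝ) (r : ℕ) (U : Set V),
      HasBias P X ρ → 0 ≤ ρ → ρ ≤ 1 → τ ≤ ρ ^ 2 ^ r → L ≤ U.ncard →
      mass P {ω | ¬ Minority (X ω) U} ≤ (1 - τ ^ 2 / 2) ^ L := by
    intro V _ X ρ r U hX hρ0 hρ1 hτρ hL
    have h1 : τ ≤ ρ := hτρ.trans (pow_le_of_le_one hρ0 hρ1 (by positivity))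
    have h2 : ρ ^ 2 ≤ 1 := pow_le_one₀ hρ0 hρ1
    have h3 : τ ^ 2 ≤ ρ ^ 2 := pow_le_pow_left₀ hτ h1 2
    calc _ ≤ (1 - ρ ^ 2 / 2) ^ U.ncard := hX.tail hP hρ0 U
      _ ≤ (1 - ρ ^ 2 / 2) ^ L :=
        pow_le_pow_of_le_one (by linarith) (by linarith [sq_nonneg ρ]) hL
      _ ≤ _ := pow_le_pow_left₀ (by linarith) (by linarith) L
  induction r with
  | zero =>
    intro V _ _ _ X ρ hX hρ0 hρ1 hτρ hL hV
    have := Fintype.ofFinite V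
    have : Finite (V →ₗ[ZMod 2] ZMod 2) := Finite.of_injective _ DFunLike.coe_injective
    have := Fintype.ofFinite (V →ₗ[ZMod 2] ZMod 2)
    let F : (V →ₗ[ZMod 2] ZMod 2) × ZMod 2 → Word V := fun i x => i.1 x + i.2
    let S : (V →ₗ[ZMod 2] ZMod 2) × ZMod 2 → Set Ω :=
      fun i => {ω | F i ≠ 0 ∧ ¬ Minority (X ω) {x | F i x ≠ 0}}
    have hsub : {ω | ¬ Good 1 V (X ω)} ⊆ ⋃ i, S i := by
      intro ω hω
      have hω' : ¬ ∀ f ∈ firstOrder V, f ≠ 0 → Minority (X ω) {x | f x ≠ 0} := hω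
      push Not at hω'
      obtain ⟨f, ⟨s, a, hs⟩, hne, hf⟩ := hω'
      obtain rfl : f = F (s, a) := funext hs
      exact Set.mem_iUnion.2 ⟨(s, a), hne, hf⟩
    have hθ : 0 ≤ (1 - τ ^ 2 / 2) ^ L :=
      (Finset.sum_nonneg fun ω _ => Set.indicator_nonneg (fun ω _ => hP ω) ω).trans
        (key V X ρ 0 Set.univ hX hρ0 hρ1 hτρ (by rw [Set.ncard_univ]; omega))
    have hS : ∀ i, mass P (S i) ≤ (1 - τ ^ 2 / 2) ^ L := by
      intro i
      by_cases hi : F i = 0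
      · have : S i = ∅ := Set.eq_empty_of_forall_notMem fun ω hω => hω.1 hi
        rw [this]
        simpa [mass] using hθ
      · refine (mass_mono hP fun ω hω => hω.2).trans (key V X ρ 0 _ hX hρ0 hρ1 hτρ ?_)
        have := card_le_two_mul_support (f := F i) ⟨i.1, i.2, fun x => rfl⟩ hi
        omega
    calc _ ≤ mass P (⋃ i, S i) := mass_mono hP hsub
      _ ≤ ∑ i, mass P (S i) := mass_iUnion_le hP S
      _ ≤ ∑ _i : (V →ₗ[ZMod 2] ZMod 2) × ZMod 2, (1 - τ ^ 2 / 2) ^ L :=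
        Finset.sum_le_sum fun i _ => hS i
      _ = (Nat.card V * 2 : ℕ) * (1 - τ ^ 2 / 2) ^ L := by
        rw [Finset.sum_const, nsmul_eq_mul, Finset.card_univ, ← Nat.card_eq_fintype_card,
          Nat.card_prod, card_dual, Nat.card_zmod]
      _ ≤ _ := by
        refine mul_le_mul_of_nonneg_right ?_ hθ
        push_cast
        linarith
  | succ r ih =>
    intro V _ _ _ X ρ hX hρ0 hρ1 hτρ hL hV
    have := Fintype.ofFinite (Line V)
    set θ := (1 - τ ^ 2 / 2) ^ L
    have hU : L ≤ (Set.univ : Set V).ncard := by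
      rw [Set.ncard_univ]
      exact (Nat.le_mul_of_pos_left L (by positivity)).trans hL
    have h0 := key V X ρ (r + 1) Set.univ hX hρ0 hρ1 hτρ hU
    have hθ : 0 ≤ θ :=
      (Finset.sum_nonneg fun ω _ => Set.indicator_nonneg (fun ω _ => hP ω) ω).trans h0
    have hB : ∀ B : Line V, mass P {ω | ¬ Good (r + 1) (V ⧸ B.1) (project B (X ω))}
        ≤ (2 * N) ^ (r + 1) * θ := by
      intro B
      have hcard := card_quotient_line B
      refine ih _ _ (ρ ^ 2) (hX.project B) (by positivity) (pow_le_one₀ hρ0 hρ1) ?_ ?_ ?_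
      · rwa [← pow_mul, ← pow_succ']
      · rw [hcard, pow_succ 2 (r + 1)] at hL
        linarith
      · refine le_trans ?_ hV
        exact_mod_cast (by omega)
    have hsub : {ω | ¬ Good (r + 2) V (X ω)} ⊆ {ω | ¬ Minority (X ω) Set.univ} ∪
        ⋃ B : Line V, {ω | ¬ Good (r + 1) (V ⧸ B.1) (project B (X ω))} := by
      intro ω hω
      by_cases h : Minority (X ω) Set.univ
      · right
        by_contra hc
        refine hω ⟨h, fun B => ?_⟩
        by_contra hB'
        exact hc (Set.mem_iUnion.2 ⟨B, hB'⟩)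
      · exact Or.inl h
    have hline : (Nat.card (Line V) : ℝ) ≤ N := by
      refine le_trans ?_ hV
      exact_mod_cast (card_line (V := V)).le.trans' (Nat.le_succ _)
    have hpow : 1 ≤ (2 * N) ^ (r + 1) := one_le_pow₀ (by linarith)
    calc _ ≤ _ := mass_mono hP hsub
      _ ≤ θ + ∑ B : Line V, mass P {ω | ¬ Good (r + 1) (V ⧸ B.1) (project B (X ω))} :=
        (mass_union_le hP _ _).trans (add_le_add h0 (mass_iUnion_le hP _))
      _ ≤ θ + ∑ _B : Line V, (2 * N) ^ (r + 1) * θ := by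
        gcongr with B
        exact hB B
      _ = θ + Nat.card (Line V) * ((2 * N) ^ (r + 1) * θ) := by
        rw [Finset.sum_const, nsmul_eq_mul, Finset.card_univ, ← Nat.card_eq_fintype_card]
      _ ≤ N * ((2 * N) ^ (r + 1) * θ) + N * ((2 * N) ^ (r + 1) * θ) := by
        gcongr
        rw [← mul_assoc]
        exact le_mul_of_one_le_left hθ (one_le_mul_of_one_le_of_one_le hN hpow)
      _ = _ := by ring


/-! ### From the binary symmetric channel to fixed weight -/

/-- The probability of an error pattern on the binary symmetric channel. -/
noncomputable def bscWeight {V : Type} [Fintype V] (p : ℝ) (e : Word V) : ℝ :=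
  ∏ x, if e x = 0 then 1 - p else p

theorem bscWeight_nonneg {V : Type} [Fintype V] {p : ℝ} (hp0 : 0 ≤ p) (hp1 : p ≤ 1) (e : Word V) :
    0 ≤ bscWeight p e := by
  refine Finset.prod_nonneg fun x _ => ?_
  split_ifs <;> linarith

theorem bscWeight_eq {V : Type} [Fintype V] (p : ℝ) (e : Word V) :
    bscWeight p e = (1 - p) ^ (Nat.card V - weight e) * p ^ weight e := by
  classical
  have h1 : weight e = (Finset.univ.filter (¬ e · = 0)).card := by
    rw [weight, ← Set.ncard_coe_finset]
    congr 1
    ext x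
    simp
  have h2 := Finset.card_filter_add_card_filter_not (s := (Finset.univ : Finset V)) (e · = 0)
  rw [← h1, Finset.card_univ, ← Nat.card_eq_fintype_card] at h2
  rw [bscWeight, Finset.prod_ite, Finset.prod_const, Finset.prod_const, ← h1,
    Nat.eq_sub_of_add_eq h2]

theorem hasBias_bscWeight {V : Type} [Fintype V] [DecidableEq V] (p : ℝ) :
    HasBias (bscWeight (V := V) p) id (1 - 2 * p) := by
  intro A
  have hterm : ∀ e : Word V, bscWeight p e * ∏ u ∈ A, sgn (id e u)
      = ∏ x, (if e x = 0 then 1 - p else p) * if x ∈ A then sgn (e x) else 1 := by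
    intro e
    rw [Finset.prod_mul_distrib, bscWeight, Finset.prod_ite_mem, Finset.univ_inter]
    rfl
  have hsum : ∀ x, (∑ z : ZMod 2, (if z = 0 then 1 - p else p) * if x ∈ A then sgn z else 1)
      = if x ∈ A then 1 - 2 * p else 1 := by
    intro x
    rw [show (Finset.univ : Finset (ZMod 2)) = {0, 1} from rfl, Finset.sum_pair (by decide)]
    by_cases hx : x ∈ A <;> simp [hx, sgn] <;> ring
  simp only [hterm]
  have := Finset.prod_univ_sum (fun _ : V => (Finset.univ : Finset (ZMod 2)))
    (fun x z => (if z = 0 then 1 - p else p) * if x ∈ A then sgn z else 1)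
  rw [Fintype.piFinset_univ] at this
  rw [← this]
  simp only [hsum]
  rw [Finset.prod_ite_mem, Finset.univ_inter, Finset.prod_const]

open scoped Nat in
-- With denominators cleared, this says that t is a mode of the binomial distribution with t + s
-- trials and success probability t/(t + s).
theorem pow_mul_factorial_le {t s j k : ℕ} (h : j + k = t + s) :
    t ^ j * s ^ k * (t ! * s !) ≤ t ^ t * s ^ s * (j ! * k !) := by
  wlog hjt : j ≤ t generalizing t s j k
  · have := this (t := s) (s := t) (j := k) (k := j) (by omega) (by omega)
    linarith
  obtain ⟨i, rfl⟩ := Nat.exists_eq_add_of_le hjt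
  obtain rfl : k = s + i := by omega
  have h1 : (j + i)! ≤ j ! * (j + i) ^ i := by
    rw [← Nat.factorial_mul_ascFactorial]
    exact Nat.mul_le_mul_left _ (Nat.ascFactorial_le_pow_add _ _)
  have h2 : s ! * s ^ i ≤ (s + i)! := by
    simpa using Nat.factorial_mul_pow_sub_le_factorial (Nat.le_add_right s i)
  calc (j + i) ^ j * s ^ (s + i) * ((j + i)! * s !)
      = (j + i) ^ j * s ^ s * ((j + i)! * (s ! * s ^ i)) := by ring
    _ ≤ (j + i) ^ j * s ^ s * ((j ! * (j + i) ^ i) * (s + i)!) := by gcongr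
    _ = _ := by ring

theorem add_pow_le_succ_mul_choose (t s : ℕ) :
    (t + s) ^ (t + s) ≤ (t + s + 1) * ((t + s).choose t * (t ^ t * s ^ s)) := by
  rw [add_pow]
  refine (Finset.sum_le_card_nsmul _ _ ((t + s).choose t * (t ^ t * s ^ s))
    fun j hj => ?_).trans_eq (by simp)
  have hj' : j ≤ t + s := Nat.lt_succ_iff.1 (Finset.mem_range.1 hj)
  obtain ⟨k, hk⟩ := Nat.exists_eq_add_of_le hj'
  have h1 := Nat.choose_mul_factorial_mul_factorial hj'
  have h2 := Nat.choose_mul_factorial_mul_factorial (Nat.le_add_right t s)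
  have h3 := pow_mul_factorial_le hk.symm
  rw [hk, Nat.add_sub_cancel_left] at h1
  rw [Nat.add_sub_cancel_left] at h2
  rw [hk, Nat.add_sub_cancel_left, ← hk]
  rw [← hk] at h1
  have hpos : 0 < j.factorial * k.factorial * (t.factorial * s.factorial) := by positivity
  refine Nat.le_of_mul_le_mul_right ?_ hpos
  calc t ^ j * s ^ k * (t + s).choose j * (j.factorial * k.factorial * (t.factorial * s.factorial))
      = (t + s).choose j * j.factorial * k.factorial *
          (t ^ j * s ^ k * (t.factorial * s.factorial)) := by ring
    _ ≤ (t + s).choose t * t.factorial * s.factorial *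
          (t ^ t * s ^ s * (j.factorial * k.factorial)) := by
        rw [h1, h2]
        gcongr
    _ = _ := by ring

theorem ncard_weight_eq {V : Type} [Finite V] (t : ℕ) :
    {e : Word V | weight e = t}.ncard = (Nat.card V).choose t := by
  classical
  have := Fintype.ofFinite V
  have h : {e : Word V | weight e = t} =
      (fun (s : Finset V) x => if x ∈ s then (1 : ZMod 2) else 0) ''
        (Finset.powersetCard t (Finset.univ : Finset V) : Set (Finset V)) := by
    ext e
    constructor
    · intro he
      refine ⟨Finset.univ.filter (e · ≠ 0), ?_, ?_⟩
      · rw [Finset.mem_coe, Finset.mem_powersetCard_univ, ← Set.ncard_coe_finset, ← he, weight]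
        congr 1
        ext x
        simp
      · funext x
        rcases zmod_two_cases (e x) with h | h <;> simp [h]
    · rintro ⟨s, hs, rfl⟩
      rw [Finset.mem_coe, Finset.mem_powersetCard_univ] at hs
      simp [weight, hs]
  rw [h, Set.ncard_image_of_injective, Set.ncard_coe_finset, Finset.card_powersetCard,
    Finset.card_univ, Nat.card_eq_fintype_card]
  intro s s' hss
  ext x
  have := congrFun hss x
  by_cases h1 : x ∈ s <;> by_cases h2 : x ∈ s' <;> simp_all

/-- An event of small probability on the binary symmetric channel with crossover probability
`t / N` is unlikely under uniformly distributed error patterns of weight `t`. -/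
theorem ncard_le_of_mass_le {V : Type} [Fintype V] [DecidableEq V] [Nonempty V] {t : ℕ}
    (ht : t ≤ Nat.card V) (S : Set (Word V)) {F : ℝ}
    (hF : mass (bscWeight (V := V) (t / Nat.card V)) S ≤ F) :
    ({e : Word V | weight e = t ∧ e ∈ S}.ncard : ℝ) ≤
      (Nat.card V + 1) * F * {e : Word V | weight e = t}.ncard := by
  classical
  obtain ⟨s, hs⟩ := Nat.exists_eq_add_of_le ht
  have hN : 0 < Nat.card V := Nat.card_pos
  rw [ncard_weight_eq]
  set N := Nat.card V
  have hN' : (0 : ℝ) < N := by exact_mod_cast hN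
  set p : ℝ := t / N
  have hNts : (N : ℝ) = t + s := by exact_mod_cast hs
  have hq : 1 - p = s / N := by
    simp only [p]
    field_simp
    linarith
  have hp0 : 0 ≤ p := by positivity
  have hp1 : p ≤ 1 := by
    have : 0 ≤ 1 - p := by rw [hq]; positivity
    linarith
  set w : ℝ := (1 - p) ^ s * p ^ t
  have hw0 : 0 ≤ w := mul_nonneg (pow_nonneg (by linarith) _) (pow_nonneg hp0 _)
  have hmass : ({e : Word V | weight e = t ∧ e ∈ S}.ncard : ℝ) * w ≤ F := by
    refine le_trans (le_of_eq ?_) ((mass_mono (bscWeight_nonneg hp0 hp1)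
      (S := {e : Word V | weight e = t ∧ e ∈ S}) fun e he => he.2).trans hF)
    rw [mass, Set.ncard_eq_toFinset_card', ← nsmul_eq_mul, ← Finset.sum_const,
      ← Finset.sum_indicator_subset _ (Finset.subset_univ _)]
    refine Finset.sum_congr rfl fun e _ => ?_
    rw [Set.coe_toFinset]
    by_cases he : e ∈ {e : Word V | weight e = t ∧ e ∈ S}
    swap
    · rw [Set.indicator_of_notMem he, Set.indicator_of_notMem he]
    rw [Set.indicator_of_mem he, Set.indicator_of_mem he, bscWeight_eq, he.1]
    change w = (1 - p) ^ (N - t) * p ^ t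
    rw [hs, Nat.add_sub_cancel_left]
  -- The most likely of the N + 1 weights is t, so it has probability at least 1/(N + 1).
  have hmode : 1 ≤ (N + 1) * (N.choose t * w) := by
    have h := add_pow_le_succ_mul_choose t s
    rw [← hs] at h
    have h' : (N : ℝ) ^ N ≤ (N + 1) * (N.choose t * (t ^ t * s ^ s)) := by exact_mod_cast h
    have hwN : w = t ^ t * s ^ s / (N : ℝ) ^ N := by
      conv_rhs => rw [hs, pow_add]
      simp only [w, hq, p, div_pow]
      rw [div_mul_div_comm]
      push_cast
      rw [← hNts]
      ring
    rw [hwN, ← mul_div_assoc, ← mul_div_assoc, one_le_div (by positivity)]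
    exact h'
  have hF0 : 0 ≤ F := le_trans (by positivity) hmass
  calc ({e : Word V | weight e = t ∧ e ∈ S}.ncard : ℝ)
      ≤ {e : Word V | weight e = t ∧ e ∈ S}.ncard * ((N + 1) * (N.choose t * w)) :=
        le_mul_of_one_le_right (by positivity) hmode
    _ = (N + 1) * ({e : Word V | weight e = t ∧ e ∈ S}.ncard * w) * N.choose t := by ring
    _ ≤ _ := by gcongr

theorem correctionProb_ge {D : WordMap} (hD : IsFirstOrderML D) {M : ℕ} (hM : 1 ≤ M) {m r L : ℕ}
    {c : Word (Fin m → ZMod 2)} (hc : c ∈ reedMuller m (r + 1)) {δ : ℝ} (hδ : 0 ≤ δ) {t : ℕ}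
    (ht : (t : ℝ) ≤ 2 ^ m / 2 * (1 - δ)) (hL : 2 ^ (r + 1) * L ≤ 2 ^ m) :
    1 - (2 ^ m + 1) * ((2 * 2 ^ m) ^ (r + 1) * (1 - (δ ^ 2 ^ r) ^ 2 / 2) ^ L) ≤
      correctionProb (decoder D M (r + 1) (Fin m → ZMod 2)) c t := by
  classical
  have hcard : Nat.card (Fin m → ZMod 2) = 2 ^ m := by simp
  have hcardR : (Nat.card (Fin m → ZMod 2) : ℝ) = 2 ^ m := by rw [hcard]; norm_num
  have hN : (0 : ℝ) < 2 ^ m := by positivity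
  have htN : t ≤ Nat.card (Fin m → ZMod 2) := by
    have : (t : ℝ) ≤ Nat.card (Fin m → ZMod 2) := by
      rw [hcardR]
      nlinarith
    exact_mod_cast this
  set p : ℝ := t / Nat.card (Fin m → ZMod 2)
  have hp : 2 * p ≤ 1 - δ := by
    simp only [p, hcardR]
    rw [← mul_div_assoc, div_le_iff₀ hN]
    linarith
  have hp0 : 0 ≤ p := by positivity
  have hbad := not_good_le (P := bscWeight (V := Fin m → ZMod 2) p) (bscWeight_nonneg hp0 (by linarith))
    (τ := δ ^ 2 ^ r) (by positivity) (L := L) (N := 2 ^ m) (one_le_pow₀ one_le_two) r (Fin m → ZMod 2) id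
    (1 - 2 * p) (hasBias_bscWeight p) (by linarith) (by linarith)
    (pow_le_pow_left₀ hδ (by linarith) _) (by rwa [hcard]) hcardR.le
  have hcount := ncard_le_of_mass_le htN _ hbad
  rw [hcardR] at hcount
  have hpos : (0 : ℝ) < {e : Word (Fin m → ZMod 2) | weight e = t}.ncard := by
    rw [ncard_weight_eq]
    exact_mod_cast Nat.choose_pos htN
  have hsub : {e : Word (Fin m → ZMod 2) | weight e = t} ⊆
      {e | weight e = t ∧ decoder D M (r + 1) (Fin m → ZMod 2) (c + e) = c} ∪
        {e | weight e = t ∧ e ∈ {e | ¬ Good (r + 1) (Fin m → ZMod 2) (id e)}} := by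
    intro e he
    by_cases h : Good (r + 1) (Fin m → ZMod 2) e
    · exact Or.inl ⟨he, decoder_eq hD hM r (Fin m → ZMod 2) c e (isRM_of_mem_reedMuller hc) h⟩
    · exact Or.inr ⟨he, h⟩
  have hle := (Set.ncard_le_ncard hsub).trans (Set.ncard_union_le _ _)
  have hle' : ({e : Word (Fin m → ZMod 2) | weight e = t}.ncard : ℝ) ≤
      {e | weight e = t ∧ decoder D M (r + 1) (Fin m → ZMod 2) (c + e) = c}.ncard +
        {e | weight e = t ∧ e ∈ {e | ¬ Good (r + 1) (Fin m → ZMod 2) (id e)}}.ncard := by exact_mod_cast hle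
  rw [correctionProb, le_div_iff₀ hpos]
  linarith

theorem gamma_nonneg {r : ℕ} {β : ℝ} (hβ : 0 ≤ β) (m : ℕ) : 0 ≤ gamma r β m := by
  have h : 0 ≤ Real.logb 2 (Real.exp 1) :=
    Real.logb_nonneg one_lt_two (Real.one_le_exp zero_le_one)
  unfold gamma
  positivity

end RPA

/-! ### The asymptotic statement -/

theorem corollary2 (r : ℕ) (hr : 2 ≤ r) (δ β : ℝ) (hδ : δ ∈ Set.Ioo (0 : ℝ) 1)
    (hβ : β ∈ Set.Ioo (0 : ℝ) 1) :
    ∀ ε : ℝ, 0 < ε → ∃ m₀ : ℕ, ∀ m : ℕ, m₀ ≤ m →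
      ∀ D : RPA.WordMap, RPA.IsFirstOrderML D → ∀ M : ℕ, 1 ≤ M →
        ∀ c ∈ RPA.reedMuller m r,
          ∀ t : ℕ, (t : ℝ) ≤ (2 : ℝ) ^ m / 2 * (1 - RPA.gamma r β m - δ) →
            1 - ε ≤ RPA.correctionProb (RPA.decoder D M r (Fin m → ZMod 2)) c t := by
  intro ε hε
  obtain ⟨r, rfl⟩ := Nat.exists_eq_add_of_le' (one_le_two.trans hr)
  set q : ℝ := 1 - (δ ^ 2 ^ r) ^ 2 / 2 with hq
  have hτ0 : 0 < (δ ^ 2 ^ r) ^ 2 := pow_pos (pow_pos hδ.1 _) _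
  have hτ1 : (δ ^ 2 ^ r) ^ 2 ≤ 1 := pow_le_one₀ (pow_pos hδ.1 _).le (pow_le_one₀ hδ.1.le hδ.2.le)
  have hq0 : 0 ≤ q := by linarith
  -- The limit is sampled at 2^k with k = m - (r + 1). Of the exponent r + 2, the union bound
  -- accounts for r + 1 and the change of error model for 1, using N + 1 ≤ 2N and 2N = 2^(r + 2) ·
  -- 2^k.
  have hlim := (tendsto_pow_const_mul_const_pow_of_abs_lt_one (r + 2)
    (show |q| < 1 by rw [abs_of_nonneg hq0]; linarith)).const_mul (((2 : ℝ) ^ (r + 2)) ^ (r + 2))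
  rw [mul_zero] at hlim
  obtain ⟨L₀, hL₀⟩ := Filter.eventually_atTop.1 (hlim.eventually (ge_mem_nhds hε))
  refine ⟨L₀ + (r + 1), fun m hm D hD M hM c hc t ht => ?_⟩
  obtain ⟨k, rfl⟩ : ∃ k, m = k + (r + 1) := Nat.exists_eq_add_of_le' (by omega)
  have hk := hL₀ (2 ^ k) ((by omega : L₀ ≤ k).trans Nat.lt_two_pow_self.le)
  have hmain := RPA.correctionProb_ge hD hM hc hδ.1.le (t := t) (L := 2 ^ k) (ht.trans ?_)
    (by rw [pow_add 2 k, mul_comm])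
  · refine le_trans ?_ hmain
    rw [← hq]
    have hN : (1 : ℝ) ≤ 2 ^ (k + (r + 1)) := one_le_pow₀ one_le_two
    have hpow : 0 ≤ (2 * (2 : ℝ) ^ (k + (r + 1))) ^ (r + 1) * q ^ 2 ^ k := by positivity
    have hexp : (2 * (2 : ℝ) ^ (k + (r + 1))) * ((2 * (2 : ℝ) ^ (k + (r + 1))) ^ (r + 1) * q ^ 2 ^ k)
        = ((2 : ℝ) ^ (r + 2)) ^ (r + 2) * (((2 ^ k : ℕ) : ℝ) ^ (r + 2) * q ^ 2 ^ k) := by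
      have : 2 * (2 : ℝ) ^ (k + (r + 1)) = 2 ^ (r + 2) * 2 ^ k := by ring
      rw [this]
      push_cast
      ring
    have := mul_le_mul_of_nonneg_right
      (show (2 : ℝ) ^ (k + (r + 1)) + 1 ≤ 2 * 2 ^ (k + (r + 1)) by linarith) hpow
    linarith
  · have := RPA.gamma_nonneg (r := r + 1) hβ.1.le (k + (r + 1))
    gcongr
    linarith
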